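/- Let $\Omega\subset\mathbb R^2$ be open and let $u:\Omega\to\mathbb R$ be (locally, linearly) semiconcave, i.e. every point of $\Omega$ is the center of an open ball $B\subset\Omega$ on which $u(x)=g(x)+K\|x\|^2$ for some concave $g:B\to\mathbb R$ and some $K\in\mathbb R$. Let $\Sigma(u)$ be the set of points of $\Omega$ at which $u$ is not differentiable. For $x\in\Omega$ let $D^*u(x)$ be the set of all limits $\lim_i Du(x_i)$, where $x_i\in\Omega$ are points of differentiability of $u$ with $x_i\to x$, and let $D^+u(x)=\operatorname{conv} D^*u(x)$ be the superdifferential. Let $x_0\in\Sigma(u)$ and suppose that $\partial D^+u(x_0)\setminus D^*u(x_0)\neq\emptyset$, where $\partial$ denotes the boundary in $\mathbb R^2$. Then there exist a Cartesian coordinate system in $\mathbb R^2$ given by a (bijective, affine) isometry $A:\mathbb R^2\to\mathbb R^2$ with $A(x_0)=(0,0)$, a number $\alpha>0$, and convex Lipschitz functions $y_1,y_2:[0,\alpha]\to\mathbb R$ such that, for $\psi(x):=(x,\,y_1(x)-y_2(x))$, $x\in[0,\alpha]$, we have $\psi(0)=(0,0)$ and $A^{-1}(\psi([0,\alpha]))\subset\Sigma(u)$.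 Moreover, the arc $A^{-1}\circ\psi$ has finite turn: the sums of the angles between consecutive edges of the polygonal lines inscribed in it are bounded. -/

import Mathlib

open Set Filter Topology

namespace SemiconcaveSing

section General

variable {E : Type*} [NormedAddCommGroup E] [InnerProductSpace ℝ E]

/-- `u` is (locally, linearly) semiconcave on `Ω`: every point of `Ω` has a ball in `Ω` on which
`u = g + K ‖·‖²` with `g` concave. Only the values of `u` on `Ω` matter. -/
def IsSemiconcaveOn (Ω : Set E) (u : E → ℝ) : Prop :=
  ∀ x ∈ Ω, ∃ δ > 0, Metric.ball x δ ⊆ Ω ∧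
    ∃ (K : ℝ) (g : E → ℝ), ConcaveOn ℝ (Metric.ball x δ) g ∧
      ∀ z ∈ Metric.ball x δ, u z = g z + K * ‖z‖ ^ 2

/-- The singular set `Σ(u)`: the points of `Ω` at which `u` is not (Fréchet) differentiable. -/
def singularSet (Ω : Set E) (u : E → ℝ) : Set E :=
  {x | x ∈ Ω ∧ ¬ DifferentiableAt ℝ u x}

/-- The set `D*u(x)` of reachable gradients: limits of `Du(xᵢ)` along sequences `xᵢ → x` of
points of `Ω` at which `u` is differentiable. -/
def reachableGradients [CompleteSpace E] (Ω : Set E) (u : E → ℝ) (x : E) : Set E :=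
  {p | ∃ z d : ℕ → E, (∀ i, z i ∈ Ω ∧ HasGradientAt u (d i) (z i)) ∧
    Tendsto z atTop (𝓝 x) ∧ Tendsto d atTop (𝓝 p)}

/-- The superdifferential `D⁺u(x)`, the convex hull of `D*u(x)`. -/
def superdifferential [CompleteSpace E] (Ω : Set E) (u : E → ℝ) (x : E) : Set E :=
  convexHull ℝ (reachableGradients Ω u x)

/-- The curve `γ : [a, b] → E` has finite turn: the turns (sums of the angles between
consecutive edges) of its inscribed polygonal lines with nonzero edges
`γ (t 0), γ (t 1), …, γ (t (n + 1))` are bounded. -/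
def HasFiniteTurn (γ : ℝ → E) (a b : ℝ) : Prop :=
  ∃ C : ℝ, ∀ (n : ℕ) (t : ℕ → ℝ),
    (∀ i ≤ n + 1, t i ∈ Icc a b) → (∀ i ≤ n, t i < t (i + 1)) →
    (∀ i ≤ n, γ (t i) ≠ γ (t (i + 1))) →
    ∑ i ∈ Finset.range n, InnerProductGeometry.angle
      (γ (t (i + 1)) - γ (t i)) (γ (t (i + 2)) - γ (t (i + 1))) ≤ C

end General

/-- The curve `x ↦ (x, y₁(x) - y₂(x))` in the Euclidean plane. -/
noncomputable def graphCurve (y₁ y₂ : ℝ → ℝ) (x : ℝ) : EuclideanSpace ℝ (Fin 2) :=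
  !₂[x, y₁ x - y₂ x]

end SemiconcaveSing

namespace SemiconcaveSing

/-! ### Reachable gradients: closedness and outer semicontinuity. -/

section ReachableGradients

variable {E : Type*} [NormedAddCommGroup E] [InnerProductSpace ℝ E] [CompleteSpace E]

/-! Take `p` in the boundary of `D⁺u(x₀)` but not in `D*u(x₀)`. Subtracting `u` from a quadratic
with value `u(x₀)` and gradient `p` at `x₀` gives a convex `f` near `x₀` with `f(x₀) = 0` and
reachable gradients `p - D*u(x₀)`. Now `0` is not reachable but lies in a face of their closed
convex hull, with outer normal `e 0`, and the face has reachable gradients on both sides of `0`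
(`exists_mem_face_inner_gt`).

Use coordinates `(s, t)` along `e 0`, `e 1`. The two subgradients on the face give `f(s, t) ≥
c₀|t|`, while gradients near `x₀` have small positive part along `e 0`, so `f(s, 0) ≤ γ s`. Hence a
minimizer `y(s)` of `f(s, ·)` lies in a thin cone around the `s`-axis. Gradients in the cone are not
small (`0` is not reachable) and have small `e 0`-component, so their `e 1`-component is bounded
away from `0`. But it would vanish at a point of differentiability minimizing `f(s, ·)`, so `f`, and
with it `u`, is singular at `(s, y(s))`.

The same bound makes the minimum sharp: `f(s, t) ≥ m(s) + c|t - y(s)|` with `m(s) = min f(s, ·)`.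
Therefore `m(s) + c y(s) = min_t (f(s, t) + c t)`, and `y = c⁻¹(m + c y) - c⁻¹ m` is a difference of
two marginals of jointly convex functions, which are convex and Lipschitz. Finite turn follows
because slopes of convex functions increase, so that the turn telescopes. -/

theorem mem_reachableGradients_iff {Ω : Set E} {u : E → ℝ} {x p : E} :
    p ∈ reachableGradients Ω u x ↔
      ∀ ε > 0, ∃ z ∈ Ω, ∃ d, HasGradientAt u d z ∧ dist z x < ε ∧ dist d p < ε := by
  constructor
  · rintro ⟨z, d, h, hz, hd⟩ ε hε
    obtain ⟨i, hi₁, hi₂⟩ := ((Metric.tendsto_nhds.1 hz ε hε).and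
      (Metric.tendsto_nhds.1 hd ε hε)).exists
    exact ⟨z i, (h i).1, d i, (h i).2, hi₁, hi₂⟩
  · intro h
    choose z hz d hd hzx hdp using fun n : ℕ => h (1 / (n + 1 : ℝ)) Nat.one_div_pos_of_nat
    refine ⟨z, d, fun i => ⟨hz i, hd i⟩, ?_, ?_⟩
    · exact tendsto_iff_dist_tendsto_zero.2 (squeeze_zero (fun _ => dist_nonneg)
        (fun i => (hzx i).le) tendsto_one_div_add_atTop_nhds_zero_nat)
    · exact tendsto_iff_dist_tendsto_zero.2 (squeeze_zero (fun _ => dist_nonneg)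
        (fun i => (hdp i).le) tendsto_one_div_add_atTop_nhds_zero_nat)

theorem isClosed_reachableGradients (Ω : Set E) (u : E → ℝ) (x : E) :
    IsClosed (reachableGradients Ω u x) := by
  refine isClosed_of_closure_subset fun p hp => mem_reachableGradients_iff.2 fun ε hε => ?_
  obtain ⟨q, hq, hpq⟩ := Metric.mem_closure_iff.1 hp (ε / 2) (half_pos hε)
  obtain ⟨z, hz, d, hd, h₁, h₂⟩ := mem_reachableGradients_iff.1 hq (ε / 2) (half_pos hε)
  refine ⟨z, hz, d, hd, h₁.trans (half_lt_self hε), ?_⟩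
  have := dist_triangle_right d p q
  linarith

/-- If gradients are bounded near `x`, they enter every neighbourhood of the set of reachable
gradients. -/
theorem exists_forall_hasGradientAt_mem [FiniteDimensional ℝ E] {f : E → ℝ} {x : E} {r C : ℝ}
    (hr : 0 < r) (hC : ∀ z ∈ Metric.ball x r, ∀ d, HasGradientAt f d z → ‖d‖ ≤ C)
    {U : Set E} (hU : IsOpen U) (hDU : reachableGradients (Metric.ball x r) f x ⊆ U) :
    ∃ ρ > 0, ρ ≤ r ∧ ∀ z ∈ Metric.ball x ρ, ∀ d, HasGradientAt f d z → d ∈ U := by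
  -- Bad gradients at points tending to `x` would accumulate at a reachable gradient, which lies in
  -- the open set `U`.
  by_contra! hcon
  have hpos : ∀ n : ℕ, (0 : ℝ) < min r (1 / (n + 1)) := fun n =>
    lt_min hr Nat.one_div_pos_of_nat
  choose z hz d hd hdU using fun n : ℕ => hcon _ (hpos n) (min_le_left _ _)
  have hzr : ∀ n, z n ∈ Metric.ball x r := fun n =>
    Metric.ball_subset_ball (min_le_left _ _) (hz n)
  obtain ⟨q, -, φ, hφ, hq⟩ := (isCompact_closedBall (0 : E) C).tendsto_subseq
    (x := d) fun n => by simpa using hC _ (hzr n) _ (hd n)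
  have hzx : Tendsto z atTop (𝓝 x) := tendsto_iff_dist_tendsto_zero.2
    (squeeze_zero (fun _ => dist_nonneg)
      (fun n => ((Metric.mem_ball.1 (hz n)).trans_le (min_le_right _ _)).le)
      tendsto_one_div_add_atTop_nhds_zero_nat)
  have hqD : q ∈ reachableGradients (Metric.ball x r) f x :=
    ⟨z ∘ φ, d ∘ φ, fun i => ⟨hzr _, hd _⟩, hzx.comp hφ.tendsto_atTop, hq⟩
  obtain ⟨n, hn⟩ := (hq.eventually (hU.mem_nhds (hDU hqD))).exists
  exact hdU _ hn

end ReachableGradients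

/-! ### Supporting lines and faces of convex hulls. -/

section Support

variable {E : Type*} [NormedAddCommGroup E] [InnerProductSpace ℝ E]

theorem exists_unit_support_of_mem_frontier [FiniteDimensional ℝ E] {C : Set E} (hC : Convex ℝ C) {p : E}
    (hp : p ∈ frontier C) : ∃ v : E, ‖v‖ = 1 ∧ ∀ q ∈ C, inner ℝ v q ≤ inner ℝ v p := by
  suffices ∃ v : E, v ≠ 0 ∧ ∀ q ∈ C, inner ℝ v q ≤ inner ℝ v p by
    obtain ⟨v, hv, h⟩ := this
    refine ⟨‖v‖⁻¹ • v, norm_smul_inv_norm hv, fun q hq => ?_⟩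
    simp only [real_inner_smul_left]
    exact mul_le_mul_of_nonneg_left (h q hq) (by positivity)
  by_cases hi : (interior C).Nonempty
  · obtain ⟨l, hl⟩ := geometric_hahn_banach_open_point hC.interior isOpen_interior hp.2
    refine ⟨(InnerProductSpace.toDual ℝ E).symm l, ?_, fun q hq => ?_⟩
    · rintro h0
      obtain ⟨w, hw⟩ := hi
      have := hl w hw
      rw [map_eq_zero_iff _ (LinearIsometryEquiv.injective _)] at h0
      simp [h0] at this
    · simp only [InnerProductSpace.toDual_symm_apply]
      have : q ∈ closure (interior C) := by
        rw [hC.closure_interior_eq_closure_of_nonempty_interior hi]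
        exact subset_closure hq
      exact closure_minimal (fun w hw => (hl w hw).le)
        (isClosed_le l.continuous continuous_const) this
  -- With empty interior, `C` lies in a proper affine subspace; a normal to it is constant on `C`,
  -- hence on its closure.
  · have hspan : affineSpan ℝ C ≠ ⊤ := fun h => hi (hC.interior_nonempty_iff_affineSpan_eq_top.2 h)
    obtain ⟨c, hc⟩ : C.Nonempty := closure_nonempty_iff.1 ⟨p, hp.1⟩
    have hdir : (affineSpan ℝ C).direction ≠ ⊤ := fun h => hspan <|
      (AffineSubspace.direction_eq_top_iff_of_nonempty ⟨c, subset_affineSpan ℝ C hc⟩).1 h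
    obtain ⟨v, hv, hv0⟩ := Submodule.exists_mem_ne_zero_of_ne_bot
      (fun h => hdir ((Submodule.orthogonal_eq_bot_iff).1 h))
    refine ⟨v, hv0, fun q hq => ?_⟩
    have key : ∀ w ∈ C, inner ℝ v w = inner ℝ v q := fun w hw => by
      have := (Submodule.mem_orthogonal' _ _).1 hv (w - q)
        (AffineSubspace.vsub_mem_direction (subset_affineSpan ℝ C hw) (subset_affineSpan ℝ C hq))
      rw [inner_sub_right] at this
      linarith
    exact (closure_minimal key (isClosed_eq (by fun_prop) continuous_const) hp.1).ge

theorem exists_inner_ge_of_mem_closure_convexHull {D : Set E} (hD : IsCompact D) {p : E}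
    (hp : p ∈ closure (convexHull ℝ D)) (v : E) : ∃ q ∈ D, inner ℝ v p ≤ inner ℝ v q := by
  have hne : D.Nonempty := convexHull_nonempty_iff.1 (closure_nonempty_iff.1 ⟨p, hp⟩)
  obtain ⟨q, hq, hmax⟩ := hD.exists_isMaxOn hne
    (f := fun w => inner ℝ v w) (by fun_prop)
  refine ⟨q, hq, ?_⟩
  have h1 : convexHull ℝ D ⊆ {w | inner ℝ v w ≤ inner ℝ v q} :=
    convexHull_min (fun w hw => hmax hw)
      (convex_halfSpace_le (innerₛₗ ℝ v).isLinear _)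
  exact closure_minimal h1 (isClosed_le (by fun_prop) continuous_const) hp

/-- On a supporting line of the convex hull of a compact set `D` through a point `p ∉ D` of its
closure there are points of `D` beyond `p` in each direction `w` of the line. -/
theorem exists_mem_face_inner_gt {D : Set E} (hD : IsCompact D) {p : E}
    (hp : p ∈ closure (convexHull ℝ D)) {v w : E}
    (hv : ∀ q ∈ D, inner ℝ v q ≤ inner ℝ v p)
    (huniq : ∀ q ∈ D, inner ℝ v q = inner ℝ v p → inner ℝ w q ≠ inner ℝ w p) :
    ∃ q ∈ D, inner ℝ v q = inner ℝ v p ∧ inner ℝ w p < inner ℝ w q := by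
  -- Tilt the supporting direction `v` slightly towards `w`. A limit of maximizers over `D` in the
  -- tilted directions lies on the face, not behind `p`, and `huniq` makes the inequality strict.
  choose q hq hle using fun n : ℕ =>
    exists_inner_ge_of_mem_closure_convexHull hD hp (v + (1 / (n + 1 : ℝ)) • w)
  simp only [inner_add_left, real_inner_smul_left] at hle
  obtain ⟨b, hb, φ, hφ, hlim⟩ := hD.tendsto_subseq hq
  have hw : ∀ n, inner ℝ w p ≤ inner ℝ w (q n) := fun n => by
    have h1 := hle n
    have h2 := hv _ (hq n)
    have h3 : (0 : ℝ) < 1 / (n + 1) := Nat.one_div_pos_of_nat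
    exact le_of_mul_le_mul_left (by linarith) h3
  have hε : Tendsto (fun n => 1 / ((φ n : ℝ) + 1)) atTop (𝓝 0) :=
    (tendsto_one_div_add_atTop_nhds_zero_nat (𝕜 := ℝ)).comp hφ.tendsto_atTop
  have hqv : Tendsto (fun n => inner ℝ v (q (φ n))) atTop (𝓝 (inner ℝ v b)) :=
    tendsto_const_nhds.inner hlim
  have hqw : Tendsto (fun n => inner ℝ w (q (φ n))) atTop (𝓝 (inner ℝ w b)) :=
    tendsto_const_nhds.inner hlim
  have hvb : inner ℝ v p ≤ inner ℝ v b := by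
    have := le_of_tendsto_of_tendsto' (tendsto_const_nhds.add (hε.mul_const (inner ℝ w p)))
      (hqv.add (hε.mul hqw)) fun n => hle (φ n)
    simpa using this
  have heq : inner ℝ v b = inner ℝ v p := le_antisymm (hv b hb) hvb
  have hwb : inner ℝ w p ≤ inner ℝ w b := ge_of_tendsto' hqw fun n => hw _
  exact ⟨b, hb, heq, lt_of_le_of_ne hwb (huniq b hb heq).symm⟩

end Support

/-! ### Gradients and limiting gradients as subgradients of a convex function. -/

section ConvexGradient

variable {E : Type*} [NormedAddCommGroup E] [InnerProductSpace ℝ E] [CompleteSpace E]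

theorem gradient_inequality {s : Set E} {f : E → ℝ} (hf : ConvexOn ℝ s f) {z d w : E}
    (hz : z ∈ s) (hw : w ∈ s) (hd : HasGradientAt f d z) : f z + inner ℝ d (w - z) ≤ f w := by
  have hconv : ConvexOn ℝ (AffineMap.lineMap z w ⁻¹' s) (f ∘ AffineMap.lineMap (k := ℝ) z w) :=
    hf.comp_affineMap _
  have hder : HasDerivAt (f ∘ AffineMap.lineMap (k := ℝ) z w) (inner ℝ d (w - z)) 0 := by
    have h1 : HasFDerivAt f (InnerProductSpace.toDual ℝ E d)
        (AffineMap.lineMap z w (0 : ℝ)) := by simpa using hd.hasFDerivAt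
    simpa using h1.comp_hasDerivAt (0 : ℝ) AffineMap.hasDerivAt_lineMap
  have := hconv.le_slope_of_hasDerivAt (x := 0) (y := 1) (by simpa using hz) (by simpa using hw)
    one_pos hder
  simp [slope_def_field] at this
  linarith

theorem norm_le_of_hasGradientAt {s : Set E} (hs : IsOpen s) {f : E → ℝ} {L : NNReal}
    (hf : LipschitzOnWith L f s) {z d : E} (hz : z ∈ s) (hd : HasGradientAt f d z) : ‖d‖ ≤ L := by
  simpa using hd.hasFDerivAt.le_of_lipschitzOn (hs.mem_nhds hz) hf

/-- Rademacher: points of differentiability have full measure in `s`, hence are dense in it. -/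
theorem exists_hasGradientAt_near [FiniteDimensional ℝ E] {s : Set E} (hs : IsOpen s) {f : E → ℝ}
    {L : NNReal} (hf : LipschitzOnWith L f s) {z : E} (hz : z ∈ s) {ε : ℝ} (hε : 0 < ε) :
    ∃ z' ∈ s, dist z' z < ε ∧ ∃ d, HasGradientAt f d z' := by
  borelize E
  have hae := hf.ae_differentiableWithinAt_of_mem (μ := MeasureTheory.volume)
  obtain ⟨z', hz', h⟩ := (MeasureTheory.Measure.dense_of_ae hae).inter_open_nonempty _
    (hs.inter Metric.isOpen_ball) ⟨z, hz, Metric.mem_ball_self hε⟩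
  exact ⟨z', hz'.1, hz'.2, _, ((h hz'.1).differentiableAt (hs.mem_nhds hz'.1)).hasGradientAt⟩

theorem reachableGradient_inequality {s : Set E} (hs : IsOpen s) {f : E → ℝ} (hf : ConvexOn ℝ s f)
    (hc : ContinuousOn f s) {x q w : E} (hx : x ∈ s) (hw : w ∈ s)
    (hq : q ∈ reachableGradients s f x) : f x + inner ℝ q (w - x) ≤ f w := by
  obtain ⟨z, d, h, hz, hd⟩ := hq
  have hlim : Tendsto (fun n => f (z n) + inner ℝ (d n) (w - z n)) atTop
      (𝓝 (f x + inner ℝ q (w - x))) :=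
    ((hc.continuousAt (hs.mem_nhds hx)).tendsto.comp hz).add
      (hd.inner (tendsto_const_nhds.sub hz))
  exact le_of_tendsto' hlim fun n => gradient_inequality hf (h n).1 hw (h n).2

/-- A subgradient obtained as a limit of gradients inherits closed conditions on gradients. -/
theorem exists_reachableGradient_mem [FiniteDimensional ℝ E] {s : Set E} (hs : IsOpen s)
    {f : E → ℝ} {L : NNReal} (hf : LipschitzOnWith L f s) {z : E} (hz : z ∈ s) {V T : Set E}
    (hV : IsOpen V) (hzV : z ∈ V) (hT : IsClosed T)
    (h : ∀ z' ∈ V, z' ∈ s → ∀ d, HasGradientAt f d z' → d ∈ T) :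
    ∃ q ∈ T, q ∈ reachableGradients s f z := by
  choose x hx hxz d hd using fun n : ℕ => exists_hasGradientAt_near (hs.inter hV)
    (hf.mono inter_subset_left) ⟨hz, hzV⟩ (Nat.one_div_pos_of_nat (α := ℝ) (n := n))
  obtain ⟨q, -, φ, hφ, hq⟩ := (isCompact_closedBall (0 : E) L).tendsto_subseq
    (x := d) fun n => by simpa using norm_le_of_hasGradientAt hs hf (hx n).1 (hd n)
  have hxlim : Tendsto x atTop (𝓝 z) := tendsto_iff_dist_tendsto_zero.2
    (squeeze_zero (fun _ => dist_nonneg) (fun n => (hxz n).le)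
      tendsto_one_div_add_atTop_nhds_zero_nat)
  exact ⟨q, hT.mem_of_tendsto hq (.of_forall fun n => h _ (hx _).2 (hx _).1 _ (hd _)),
    x ∘ φ, d ∘ φ, fun i => ⟨(hx _).1, hd _⟩, hxlim.comp hφ.tendsto_atTop, hq⟩

end ConvexGradient

/-! ### Finite turn of graphs of differences of convex functions. -/

section FiniteTurn

theorem abs_arctan_sub_arctan_le (a b : ℝ) : |Real.arctan a - Real.arctan b| ≤ |a - b| := by
  have : LipschitzWith 1 Real.arctan :=
    lipschitzWith_of_nnnorm_deriv_le Real.differentiable_arctan fun x => by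
      rw [Real.deriv_arctan, ← NNReal.coe_le_coe, coe_nnnorm, Real.norm_eq_abs,
        abs_of_pos (by positivity), NNReal.coe_one, div_le_one (by positivity)]
      nlinarith [sq_nonneg x]
  simpa [Real.dist_eq] using this.dist_le_mul a b

/-- The angle equals `|arctan a - arctan b|`, and `arctan` is 1-Lipschitz. -/
theorem angle_one_slope_le (a b : ℝ) :
    InnerProductGeometry.angle (!₂[1, a] : EuclideanSpace ℝ (Fin 2)) !₂[1, b] ≤ |a - b| := by
  have hcos : InnerProductGeometry.angle (!₂[1, a] : EuclideanSpace ℝ (Fin 2)) !₂[1, b]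
      = |Real.arctan a - Real.arctan b| := by
    have h1 := Real.neg_pi_div_two_lt_arctan a
    have h2 := Real.arctan_lt_pi_div_two a
    have h3 := Real.neg_pi_div_two_lt_arctan b
    have h4 := Real.arctan_lt_pi_div_two b
    rw [← Real.arccos_cos (abs_nonneg (Real.arctan a - Real.arctan b))
      (abs_le.2 ⟨by linarith, by linarith⟩), Real.cos_abs, Real.cos_sub, Real.cos_arctan,
      Real.cos_arctan, Real.sin_arctan, Real.sin_arctan, InnerProductGeometry.angle]
    congr 1
    simp [EuclideanSpace.norm_eq, PiLp.inner_apply, Fin.sum_univ_two]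
    field_simp
  rw [hcos]
  exact abs_arctan_sub_arctan_le a b

theorem angle_edge_le {p q a b : ℝ} (hp : 0 < p) (hq : 0 < q) :
    InnerProductGeometry.angle (!₂[p, p * a] : EuclideanSpace ℝ (Fin 2)) !₂[q, q * b]
      ≤ |a - b| := by
  have h : ∀ r c : ℝ, (!₂[r, r * c] : EuclideanSpace ℝ (Fin 2)) = r • !₂[1, c] := fun r c => by
    ext i; fin_cases i <;> simp
  rw [h p, h q, InnerProductGeometry.angle_smul_left_of_pos _ _ hp,
    InnerProductGeometry.angle_smul_right_of_pos _ _ hq]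
  exact angle_one_slope_le a b

theorem graphCurve_sub (y₁ y₂ : ℝ → ℝ) {s t : ℝ} (h : s < t) :
    graphCurve y₁ y₂ t - graphCurve y₁ y₂ s =
      !₂[t - s, (t - s) * (slope y₁ s t - slope y₂ s t)] := by
  have : t - s ≠ 0 := (sub_pos.2 h).ne'
  ext i
  fin_cases i
  · simp [graphCurve]
  · simp [graphCurve, slope_def_field]
    field_simp
    ring

theorem abs_slope_le {y : ℝ → ℝ} {S : Set ℝ} {K : NNReal} (h : LipschitzOnWith K y S) {s t : ℝ}
    (hs : s ∈ S) (ht : t ∈ S) : |slope y s t| ≤ K := by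
  have := h.dist_le_mul t ht s hs
  rw [Real.dist_eq, Real.dist_eq] at this
  rw [slope_def_field, abs_div]
  exact div_le_of_le_mul₀ (abs_nonneg _) K.2 this

theorem slope_le_slope {y : ℝ → ℝ} {S : Set ℝ} (h : ConvexOn ℝ S y) {a b c : ℝ} (ha : a ∈ S)
    (hc : c ∈ S) (hab : a < b) (hbc : b < c) : slope y a b ≤ slope y b c := by
  rw [slope_def_field, slope_def_field]
  exact h.slope_mono_adjacent ha hc hab hbc

theorem hasFiniteTurn_graphCurve {y₁ y₂ : ℝ → ℝ} {a b : ℝ} (hc₁ : ConvexOn ℝ (Icc a b) y₁)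
    (hc₂ : ConvexOn ℝ (Icc a b) y₂) (hl₁ : ∃ K, LipschitzOnWith K y₁ (Icc a b))
    (hl₂ : ∃ K, LipschitzOnWith K y₂ (Icc a b)) : HasFiniteTurn (graphCurve y₁ y₂) a b := by
  obtain ⟨K₁, hK₁⟩ := hl₁
  obtain ⟨K₂, hK₂⟩ := hl₂
  refine ⟨2 * K₁ + 2 * K₂, fun n t ht hlt _ => ?_⟩
  -- The slopes of `y₁ - y₂` need not be monotone, but each change is dominated by the increase of
  -- the sum of the two slopes, which telescopes.
  set F : ℕ → ℝ := fun i => slope y₁ (t i) (t (i + 1)) + slope y₂ (t i) (t (i + 1)) with hF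
  have hle : ∀ i ∈ Finset.range n, InnerProductGeometry.angle
      (graphCurve y₁ y₂ (t (i + 1)) - graphCurve y₁ y₂ (t i))
      (graphCurve y₁ y₂ (t (i + 2)) - graphCurve y₁ y₂ (t (i + 1))) ≤ F (i + 1) - F i := by
    intro i hi
    have hi := Finset.mem_range.1 hi
    have h1 : t i < t (i + 1) := hlt i hi.le
    have h2 : t (i + 1) < t (i + 2) := hlt (i + 1) hi
    rw [graphCurve_sub _ _ h1, graphCurve_sub _ _ h2]
    refine (angle_edge_le (sub_pos.2 h1) (sub_pos.2 h2)).trans ?_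
    have ha := ht i (by omega)
    have hc := ht (i + 2) (by omega)
    have e1 := slope_le_slope hc₁ ha hc h1 h2
    have e2 := slope_le_slope hc₂ ha hc h1 h2
    simp only [hF, add_assoc, one_add_one_eq_two]
    rw [abs_le]
    constructor <;> linarith
  refine (Finset.sum_le_sum hle).trans ?_
  rw [Finset.sum_range_sub]
  have b1 := abs_le.1 (abs_slope_le hK₁ (ht n (by omega)) (ht (n + 1) le_rfl))
  have b2 := abs_le.1 (abs_slope_le hK₂ (ht n (by omega)) (ht (n + 1) le_rfl))
  have b3 := abs_le.1 (abs_slope_le hK₁ (ht 0 (by omega)) (ht (0 + 1) (by omega)))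
  have b4 := abs_le.1 (abs_slope_le hK₂ (ht 0 (by omega)) (ht (0 + 1) (by omega)))
  simp only [hF]
  linarith

theorem HasFiniteTurn.comp_affineIsometryEquiv {E F : Type*} [NormedAddCommGroup E]
    [InnerProductSpace ℝ E] [NormedAddCommGroup F] [InnerProductSpace ℝ F] {γ : ℝ → E} {a b : ℝ}
    (h : HasFiniteTurn γ a b) (A : E ≃ᵃⁱ[ℝ] F) : HasFiniteTurn (fun x => A (γ x)) a b := by
  obtain ⟨C, hC⟩ := h
  refine ⟨C, fun n t ht hlt hne => ?_⟩
  have key : ∀ x y, A x - A y = A.linearIsometryEquiv (x - y) := fun x y => by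
    simpa using (A.map_vsub x y).symm
  have := hC n t ht hlt fun i hi h => hne i hi (by simp only [h])
  refine le_trans (le_of_eq (Finset.sum_congr rfl fun i _ => ?_)) this
  rw [key, key]
  exact A.linearIsometryEquiv.toLinearIsometry.angle_map _ _

end FiniteTurn

/-! ### Marginals of convex functions and differences of convex functions. -/

section Marginal

/-- The value function of a jointly convex minimization problem is convex. -/
theorem convexOn_marginal {S T : Set ℝ} {G : ℝ → ℝ → ℝ} {y : ℝ → ℝ} (hS : Convex ℝ S)
    (hG : ConvexOn ℝ (S ×ˢ T) fun p => G p.1 p.2) (hy : ∀ s ∈ S, y s ∈ T)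
    (hmin : ∀ s ∈ S, ∀ t ∈ T, G s (y s) ≤ G s t) : ConvexOn ℝ S fun s => G s (y s) := by
  refine ⟨hS, fun s hs s' hs' a b ha hb hab => ?_⟩
  have h1 := hG.1 (x := (s, y s)) ⟨hs, hy s hs⟩ (y := (s', y s')) ⟨hs', hy s' hs'⟩ ha hb hab
  exact (hmin _ (hS hs hs' ha hb hab) _ h1.2).trans
    (hG.2 (x := (s, y s)) ⟨hs, hy s hs⟩ (y := (s', y s')) ⟨hs', hy s' hs'⟩ ha hb hab)

theorem lipschitzOnWith_marginal {S T : Set ℝ} {G : ℝ → ℝ → ℝ} {y : ℝ → ℝ} {L : NNReal}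
    (hL : ∀ t ∈ T, LipschitzOnWith L (fun s => G s t) S) (hy : ∀ s ∈ S, y s ∈ T)
    (hmin : ∀ s ∈ S, ∀ t ∈ T, G s (y s) ≤ G s t) :
    LipschitzOnWith L (fun s => G s (y s)) S := by
  refine LipschitzOnWith.of_le_add_mul L fun s hs s' hs' => ?_
  exact (hmin s hs _ (hy s' hs')).trans ((hL _ (hy s' hs')).le_add_mul hs hs')

/-- If each slice `H s` of a jointly convex function has a minimizer `y s` with linear growth at a
uniform rate, then `y` is a difference of two convex Lipschitz functions. -/
theorem exists_convexOn_sub_of_sharp_minimizer {S T : Set ℝ} {H : ℝ → ℝ → ℝ} {y : ℝ → ℝ}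
    {L : NNReal} {c : ℝ} (hc : 0 < c) (hS : Convex ℝ S)
    (hH : ConvexOn ℝ (S ×ˢ T) fun p => H p.1 p.2)
    (hL : ∀ t ∈ T, LipschitzOnWith L (fun s => H s t) S) (hy : ∀ s ∈ S, y s ∈ T)
    (hmin : ∀ s ∈ S, ∀ t ∈ T, H s (y s) + c * |t - y s| ≤ H s t) :
    ∃ y₁ y₂ : ℝ → ℝ, ConvexOn ℝ S y₁ ∧ (∃ K, LipschitzOnWith K y₁ S) ∧ ConvexOn ℝ S y₂ ∧
      (∃ K, LipschitzOnWith K y₂ S) ∧ ∀ s, y₁ s - y₂ s = y s := by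
  have hci : 0 ≤ c⁻¹ := by positivity
  -- For `|k| ≤ c`, sharpness keeps `y s` a minimizer after adding `k * t`. The cases `k = c` and `k
  -- = 0` give `y₁` and `y₂`.
  have main : ∀ k : ℝ, |k| ≤ c →
      ConvexOn ℝ S (fun s => c⁻¹ * (H s (y s) + k * y s)) ∧
      ∃ K, LipschitzOnWith K (fun s => c⁻¹ * (H s (y s) + k * y s)) S := by
    intro k hk
    have hm : ∀ s ∈ S, ∀ t ∈ T, H s (y s) + k * y s ≤ H s t + k * t := fun s hs t ht => by
      have h1 := hmin s hs t ht
      have h2 : -(k * (t - y s)) ≤ c * |t - y s| :=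
        (neg_le_abs _).trans ((abs_mul _ _).trans_le
          (mul_le_mul_of_nonneg_right hk (abs_nonneg _)))
      linarith
    have hconv : ConvexOn ℝ (S ×ˢ T) fun p : ℝ × ℝ => H p.1 p.2 + k * p.2 :=
      hH.add (((k • LinearMap.snd ℝ ℝ ℝ).convexOn hH.1))
    refine ⟨(convexOn_marginal (G := fun s t => H s t + k * t) hS hconv hy hm).smul hci,
      ‖c⁻¹‖₊ * L, ?_⟩
    have := lipschitzOnWith_marginal (G := fun s t => H s t + k * t) (L := L)
      (fun t ht => LipschitzOnWith.of_dist_le_mul fun s hs s' hs' => by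
        simpa [Real.dist_eq] using (hL t ht).dist_le_mul s hs s' hs') hy hm
    exact (lipschitzWith_smul c⁻¹).comp_lipschitzOnWith this
  obtain ⟨a1, a2⟩ := main c (abs_of_pos hc).le
  obtain ⟨b1, b2⟩ := main 0 (by simpa using hc.le)
  refine ⟨_, _, a1, a2, b1, b2, fun s => ?_⟩
  field_simp
  ring

end Marginal

/-! ### Sharp minima in one variable. -/

section SharpMinimum

/-- A minimum of a function whose slopes near the minimizer are bounded away from zero is sharp. -/
theorem sharp_minimum_of_slopes {T I : Set ℝ} {φ : ℝ → ℝ} {c t₀ : ℝ}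
    (hI : I ∈ 𝓝 t₀) (hIT : I ⊆ T) (hmin : ∀ t ∈ T, φ t₀ ≤ φ t)
    (hslope : ∀ t ∈ I, ∃ q, c ≤ |q| ∧ ∀ t' ∈ T, φ t + q * (t' - t) ≤ φ t') :
    ∀ t ∈ T, φ t₀ + c * |t - t₀| ≤ φ t := by
  intro t ht
  have ht₀ : t₀ ∈ T := hIT (mem_of_mem_nhds hI)
  have hcont : Continuous fun t₁ : ℝ => φ t₀ + c * |t - t₁| := by fun_prop
  rcases lt_trichotomy t t₀ with h | rfl | h
  · refine le_of_tendsto ((hcont.tendsto t₀).mono_left nhdsWithin_le_nhds)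
      (?_ : ∀ᶠ t₁ in 𝓝[<] t₀, φ t₀ + c * |t - t₁| ≤ φ t)
    filter_upwards [mem_nhdsWithin_of_mem_nhds hI, Ioo_mem_nhdsLT h] with t₁ h₁ h₂
    obtain ⟨q, hq, hle⟩ := hslope t₁ h₁
    have e1 := hle t₀ ht₀
    have e2 := hmin t₁ (hIT h₁)
    have e3 := hle t ht
    have hq0 : q ≤ 0 := by
      by_contra! hq0
      nlinarith [mul_pos hq0 (sub_pos.2 h₂.2)]
    rw [abs_of_nonpos hq0] at hq
    rw [abs_of_neg (sub_neg.2 h₂.1)]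
    nlinarith [mul_le_mul_of_nonneg_right hq (sub_pos.2 h₂.1).le]
  · simp
  · refine le_of_tendsto ((hcont.tendsto t₀).mono_left nhdsWithin_le_nhds)
      (?_ : ∀ᶠ t₁ in 𝓝[>] t₀, φ t₀ + c * |t - t₁| ≤ φ t)
    filter_upwards [mem_nhdsWithin_of_mem_nhds hI, Ioo_mem_nhdsGT h] with t₁ h₁ h₂
    obtain ⟨q, hq, hle⟩ := hslope t₁ h₁
    have e1 := hle t₀ ht₀
    have e2 := hmin t₁ (hIT h₁)
    have e3 := hle t ht
    have hq0 : 0 ≤ q := by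
      by_contra! hq0
      nlinarith [mul_pos_of_neg_of_neg hq0 (sub_neg.2 h₂.1)]
    rw [abs_of_nonneg hq0] at hq
    rw [abs_of_pos (sub_pos.2 h₂.2)]
    nlinarith [mul_le_mul_of_nonneg_right hq (sub_pos.2 h₂.2).le]

end SharpMinimum

/-! ### The singular arc of a convex function in adapted coordinates. -/

section Propagation

variable {E : Type*} [NormedAddCommGroup E] [InnerProductSpace ℝ E]

/-- The point with coordinates `(s, t)` in the frame with origin `x₀` and axes `e 0`, `e 1`. -/
noncomputable def framePoint (e : OrthonormalBasis (Fin 2) ℝ E) (x₀ : E) (s t : ℝ) : E :=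
  x₀ + (s • e 0 + t • e 1)

variable (e : OrthonormalBasis (Fin 2) ℝ E) {x₀ : E}

theorem inner_eq_sum_coordinates (x y : E) :
    inner ℝ x y = inner ℝ (e 0) x * inner ℝ (e 0) y + inner ℝ (e 1) x * inner ℝ (e 1) y := by
  rw [← e.sum_inner_mul_inner x y, Fin.sum_univ_two, real_inner_comm x, real_inner_comm x]

theorem inner_zero_framePoint_sub (s t : ℝ) : inner ℝ (e 0) (framePoint e x₀ s t - x₀) = s := by
  simp [framePoint, inner_add_right, real_inner_smul_right, e.inner_eq_ite]

theorem inner_one_framePoint_sub (s t : ℝ) : inner ℝ (e 1) (framePoint e x₀ s t - x₀) = t := by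
  simp [framePoint, inner_add_right, real_inner_smul_right, e.inner_eq_ite]

theorem inner_framePoint_sub (q : E) (s t : ℝ) :
    inner ℝ q (framePoint e x₀ s t - x₀) = inner ℝ (e 0) q * s + inner ℝ (e 1) q * t := by
  rw [inner_eq_sum_coordinates e, inner_zero_framePoint_sub, inner_one_framePoint_sub]

theorem framePoint_sub_framePoint (s t t' : ℝ) :
    framePoint e x₀ s t' - framePoint e x₀ s t = (t' - t) • e 1 := by
  simp only [framePoint, sub_smul]
  abel

theorem framePoint_mem_ball {s t ρ : ℝ} (h : |s| + |t| < ρ) :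
    framePoint e x₀ s t ∈ Metric.ball x₀ ρ := by
  rw [mem_ball_iff_norm, framePoint, add_sub_cancel_left]
  refine (norm_add_le _ _).trans_lt ?_
  simpa [norm_smul] using h

theorem continuous_framePoint (s : ℝ) : Continuous (framePoint e x₀ s) := by
  unfold framePoint
  fun_prop

theorem framePoint_combo {a b : ℝ} (hab : a + b = 1) (s t s' t' : ℝ) :
    framePoint e x₀ (a * s + b * s') (a * t + b * t') =
      a • framePoint e x₀ s t + b • framePoint e x₀ s' t' := by
  have : x₀ = a • x₀ + b • x₀ := by rw [← add_smul, hab, one_smul]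
  simp only [framePoint]
  nth_rewrite 1 [this]
  module

theorem convexOn_framePoint {f : E → ℝ} {B : Set E} (hf : ConvexOn ℝ B f) {S T : Set ℝ}
    (hS : Convex ℝ S) (hT : Convex ℝ T) (hB : ∀ s ∈ S, ∀ t ∈ T, framePoint e x₀ s t ∈ B) :
    ConvexOn ℝ (S ×ˢ T) fun p : ℝ × ℝ => f (framePoint e x₀ p.1 p.2) := by
  refine ⟨hS.prod hT, fun p hp q hq a b ha hb hab => ?_⟩
  have := hf.2 (hB _ hp.1 _ hp.2) (hB _ hq.1 _ hq.2) ha hb hab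
  rw [← framePoint_combo e hab] at this
  exact this

theorem lipschitzOnWith_framePoint {f : E → ℝ} {B : Set E} {L : NNReal}
    (hf : LipschitzOnWith L f B) {S : Set ℝ} {t : ℝ} (hB : ∀ s ∈ S, framePoint e x₀ s t ∈ B) :
    LipschitzOnWith L (fun s => f (framePoint e x₀ s t)) S := by
  refine LipschitzOnWith.of_dist_le_mul fun s hs s' hs' => ?_
  refine (hf.dist_le_mul _ (hB s hs) _ (hB s' hs')).trans_eq ?_
  have : framePoint e x₀ s t - framePoint e x₀ s' t = (s - s') • e 0 := by
    simp only [framePoint, sub_smul]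
    abel
  rw [dist_eq_norm, this, norm_smul]
  simp [Real.dist_eq]

/-- Propagation of nonsmoothness of a convex function along the outer normal `e 0` of an edge of
its subdifferential at `x₀` when the edge contains the nonreachable subgradient `0`. -/
theorem exists_dc_arc_of_convexOn [FiniteDimensional ℝ E] {f : E → ℝ} {r : ℝ} (hr : 0 < r)
    (hf : ConvexOn ℝ (Metric.ball x₀ r) f) {L : NNReal}
    (hL : LipschitzOnWith L f (Metric.ball x₀ r)) (hfx : f x₀ = 0)
    (h0 : (0 : E) ∉ reachableGradients (Metric.ball x₀ r) f x₀)
    (hsupp : ∀ q ∈ reachableGradients (Metric.ball x₀ r) f x₀, inner ℝ (e 0) q ≤ 0)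
    (hneg : ∃ a ∈ reachableGradients (Metric.ball x₀ r) f x₀,
      inner ℝ (e 0) a = 0 ∧ inner ℝ (e 1) a < 0)
    (hpos : ∃ b ∈ reachableGradients (Metric.ball x₀ r) f x₀,
      inner ℝ (e 0) b = 0 ∧ 0 < inner ℝ (e 1) b) :
    ∃ α > 0, ∃ y₁ y₂ : ℝ → ℝ, ConvexOn ℝ (Icc 0 α) y₁ ∧
      (∃ K, LipschitzOnWith K y₁ (Icc 0 α)) ∧ ConvexOn ℝ (Icc 0 α) y₂ ∧
      (∃ K, LipschitzOnWith K y₂ (Icc 0 α)) ∧ y₁ 0 - y₂ 0 = 0 ∧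
      ∀ s ∈ Ioc 0 α, framePoint e x₀ s (y₁ s - y₂ s) ∈ Metric.ball x₀ r ∧
        ¬ DifferentiableAt ℝ f (framePoint e x₀ s (y₁ s - y₂ s)) := by
  have hopen : IsOpen (Metric.ball x₀ r) := Metric.isOpen_ball
  have hx₀ : x₀ ∈ Metric.ball x₀ r := Metric.mem_ball_self hr
  set D := reachableGradients (Metric.ball x₀ r) f x₀ with hD
  -- linear growth in the direction of the edge
  obtain ⟨c₀, hc₀, hgrow⟩ : ∃ c₀ > 0, ∀ s t, framePoint e x₀ s t ∈ Metric.ball x₀ r →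
      c₀ * |t| ≤ f (framePoint e x₀ s t) := by
    obtain ⟨a, ha, ha0, ha1⟩ := hneg
    obtain ⟨b, hb, hb0, hb1⟩ := hpos
    refine ⟨min (-inner ℝ (e 1) a) (inner ℝ (e 1) b), lt_min (neg_pos.2 ha1) hb1,
      fun s t hst => ?_⟩
    have h1 := reachableGradient_inequality hopen hf hL.continuousOn hx₀ hst ha
    have h2 := reachableGradient_inequality hopen hf hL.continuousOn hx₀ hst hb
    rw [inner_framePoint_sub e, hfx] at h1 h2
    rw [ha0] at h1
    rw [hb0] at h2
    rcases abs_cases t with ⟨h, h'⟩ | ⟨h, h'⟩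
    · rw [h]
      nlinarith [mul_le_mul_of_nonneg_right
        (min_le_right (-inner ℝ (e 1) a) (inner ℝ (e 1) b)) h']
    · rw [h]
      nlinarith [mul_le_mul_of_nonneg_right
        (min_le_left (-inner ℝ (e 1) a) (inner ℝ (e 1) b)) (neg_pos.2 h').le]
  obtain ⟨ε, hε, hεD⟩ : ∃ ε > 0, ∀ q ∈ D, ε < ‖q‖ := by
    obtain ⟨ε, hε, h⟩ := Metric.isOpen_iff.1
      (isClosed_reachableGradients (Metric.ball x₀ r) f x₀).isOpen_compl 0 h0
    refine ⟨ε / 2, half_pos hε, fun q hq => ?_⟩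
    by_contra! hle
    exact h (by simpa using hle.trans_lt (half_lt_self hε)) hq
  -- `η` is the aperture of the cone: there the term `d₁ * t` is at most `L * η * s ≤ (ε / 2) * s`.
  obtain ⟨η, hη, hη1, hηL⟩ : ∃ η > 0, η ≤ 1 ∧ L * η ≤ ε / 2 := by
    refine ⟨min 1 (ε / (2 * (L + 1))), by positivity, min_le_left _ _, ?_⟩
    calc (L : ℝ) * min 1 (ε / (2 * (L + 1))) ≤ (L + 1) * (ε / (2 * (L + 1))) := by
          gcongr
          · exact le_add_of_nonneg_right zero_le_one
          · exact min_le_right _ _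
      _ = ε / 2 := by field_simp
  -- `γ` bounds the growth along the axis; `γ < c₀ * η` will force the minimizers into the cone.
  obtain ⟨γ, hγ, hγε, hγη⟩ : ∃ γ > 0, γ ≤ ε / 2 ∧ γ < c₀ * η :=
    ⟨min (ε / 2) (c₀ * η / 2), by positivity, min_le_left _ _,
      (min_le_right _ _).trans_lt (half_lt_self (by positivity))⟩
  obtain ⟨ρ, hρ, hρr, hgrad⟩ := exists_forall_hasGradientAt_mem hr
    (fun z hz d hd => norm_le_of_hasGradientAt hopen hL hz hd)
    (U := {d | inner ℝ (e 0) d < γ} ∩ {d | ε < ‖d‖})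
    ((isOpen_lt (by fun_prop) continuous_const).inter (isOpen_lt continuous_const continuous_norm))
    (fun q hq => ⟨(hsupp q hq).trans_lt hγ, hεD q hq⟩)
  have hsub : Metric.ball x₀ ρ ⊆ Metric.ball x₀ r := Metric.ball_subset_ball hρr
  -- the transversal derivative is bounded away from zero in a cone
  set V : Set E := Metric.ball x₀ ρ ∩
    {z | |inner ℝ (e 1) (z - x₀)| < η * inner ℝ (e 0) (z - x₀)} with hV
  have hVopen : IsOpen V := Metric.isOpen_ball.inter (isOpen_lt (by fun_prop) (by fun_prop))
  have hVgrad : ∀ z ∈ V, ∀ d, HasGradientAt f d z → ε / 2 ≤ |inner ℝ (e 1) d| := by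
    rintro z ⟨hz, hcone⟩ d hd
    obtain ⟨h1, h2⟩ := hgrad z hz d hd
    simp only [mem_ofPred_eq] at h1 h2 hcone
    have hz' := hsub hz
    have h3 := gradient_inequality hf hz' hx₀ hd
    have hzf : framePoint e x₀ (inner ℝ (e 0) (z - x₀)) (inner ℝ (e 1) (z - x₀)) = z := by
      have := e.sum_repr' (z - x₀)
      rw [Fin.sum_univ_two] at this
      rw [framePoint, this, add_sub_cancel]
    have h4 : 0 ≤ f z := by
      have := hgrow _ _ (hzf.symm ▸ hz')
      rw [hzf] at this
      exact (by positivity : (0 : ℝ) ≤ _).trans this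
    have h5 := norm_le_of_hasGradientAt hopen hL hz' hd
    have h6 : ‖d‖ ^ 2 = inner ℝ (e 0) d ^ 2 + inner ℝ (e 1) d ^ 2 := by
      rw [← real_inner_self_eq_norm_sq, inner_eq_sum_coordinates e]
      ring
    rw [← neg_sub z x₀, inner_neg_right, inner_eq_sum_coordinates e, hfx] at h3
    set s := inner ℝ (e 0) (z - x₀)
    set t := inner ℝ (e 1) (z - x₀)
    set d₀ := inner ℝ (e 0) d
    set d₁ := inner ℝ (e 1) d
    have hs : 0 < s := pos_of_mul_pos_right ((abs_nonneg t).trans_lt hcone) hη.le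
    have h7 : |d₁| ≤ L := (abs_le_of_sq_le_sq (by nlinarith [sq_nonneg d₀]) (norm_nonneg d)).trans h5
    have h8 : d₁ * t ≤ L * (η * s) := (le_abs_self _).trans <| (abs_mul _ _).trans_le <|
      mul_le_mul h7 hcone.le (abs_nonneg _) L.2
    -- The subgradient inequality from `z` to `x₀`, with `f z ≥ 0 = f x₀`, gives `d₀ * s + d₁ * t ≥
    -- 0`.
    have h9 : -(ε / 2) ≤ d₀ := by
      by_contra! hlt
      nlinarith [mul_lt_mul_of_pos_right hlt hs, mul_le_mul_of_nonneg_right hηL hs.le]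
    have h10 : d₀ ^ 2 ≤ (ε / 2) ^ 2 := sq_le_sq' h9 (h1.le.trans hγε)
    have h11 : ε ^ 2 ≤ ‖d‖ ^ 2 := by gcongr
    refine (abs_of_pos (half_pos hε)).symm.trans_le (sq_le_sq.1 ?_)
    nlinarith
  set α := ρ / 4 with hα
  have hαpos : 0 < α := by positivity
  have hball : ∀ s ∈ Icc 0 α, ∀ t ∈ Icc (-α) α, framePoint e x₀ s t ∈ Metric.ball x₀ ρ := by
    intro s hs t ht
    refine framePoint_mem_ball e ?_
    have h1 : |s| ≤ α := abs_le.2 ⟨by linarith [hs.1], hs.2⟩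
    have h2 : |t| ≤ α := abs_le.2 ht
    linarith
  -- The rate `c₀` serves the slice `s = 0`, and `ε / 2` the slices `s > 0`.
  set c := min c₀ (ε / 2) with hc
  have hcpos : 0 < c := lt_min hc₀ (half_pos hε)
  have hT0 : (0 : ℝ) ∈ Icc (-α) α := ⟨by linarith, hαpos.le⟩
  have main : ∀ s ∈ Icc 0 α, ∃ t₀ ∈ Icc (-α) α,
      (∀ t ∈ Icc (-α) α,
        f (framePoint e x₀ s t₀) + c * |t - t₀| ≤ f (framePoint e x₀ s t)) ∧
      (s = 0 → t₀ = 0) ∧ (0 < s → ¬ DifferentiableAt ℝ f (framePoint e x₀ s t₀)) := by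
    intro s hs
    rcases hs.1.eq_or_lt with rfl | hspos
    · refine ⟨0, hT0, fun t ht => ?_, fun _ => rfl, fun h => (lt_irrefl _ h).elim⟩
      have h1 := hgrow 0 t (hsub (hball 0 hs t ht))
      have h2 : framePoint e x₀ 0 0 = x₀ := by simp [framePoint]
      rw [h2, hfx, zero_add, sub_zero]
      exact (mul_le_mul_of_nonneg_right (min_le_left _ _) (abs_nonneg t)).trans h1
    obtain ⟨t₀, ht₀, hmin⟩ := (isCompact_Icc (a := -α) (b := α)).exists_isMinOn ⟨0, hT0⟩
      (f := fun t => f (framePoint e x₀ s t))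
      (hL.continuousOn.comp (continuous_framePoint e s).continuousOn
        fun t ht => hsub (hball s hs t ht))
    have hmin' : ∀ t ∈ Icc (-α) α, f (framePoint e x₀ s t₀) ≤ f (framePoint e x₀ s t) :=
      fun t ht => hmin ht
    have haxis : f (framePoint e x₀ s 0) ≤ γ * s := by
      obtain ⟨q, hq, hqD⟩ := exists_reachableGradient_mem hopen hL (hsub (hball s hs 0 hT0))
        Metric.isOpen_ball (hball s hs 0 hT0)
        (T := {q | inner ℝ (e 0) q ≤ γ}) (isClosed_le (by fun_prop) continuous_const)
        (fun z hz _ d hd => le_of_lt (show inner ℝ (e 0) d < γ from (hgrad z hz d hd).1))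
      have h1 := reachableGradient_inequality hopen hf hL.continuousOn
        (hsub (hball s hs 0 hT0)) hx₀ hqD
      rw [← neg_sub, inner_neg_right, inner_framePoint_sub e, hfx] at h1
      nlinarith [mul_le_mul_of_nonneg_right (show inner ℝ (e 0) q ≤ γ from hq) hspos.le]
    -- `c₀ * |t₀| ≤ f(s, t₀) ≤ f(s, 0) ≤ γ * s < c₀ * η * s`.
    have ht₀s : |t₀| < η * s := by
      have h1 := hgrow s t₀ (hsub (hball s hs t₀ ht₀))
      have h2 := hmin' 0 hT0
      refine lt_of_mul_lt_mul_left (a := c₀) ?_ hc₀.le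
      nlinarith [mul_lt_mul_of_pos_right hγη hspos]
    have hIT : Ioo (-(η * s)) (η * s) ⊆ Icc (-α) α := by
      have : η * s ≤ α := by nlinarith [hs.2]
      exact fun t ht => ⟨by linarith [ht.1], by linarith [ht.2]⟩
    have hI : Ioo (-(η * s)) (η * s) ∈ 𝓝 t₀ :=
      Ioo_mem_nhds (abs_lt.1 ht₀s).1 (abs_lt.1 ht₀s).2
    have hmemV : ∀ t ∈ Ioo (-(η * s)) (η * s), framePoint e x₀ s t ∈ V := fun t ht => by
      refine ⟨hball s hs t (hIT ht), ?_⟩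
      rw [mem_ofPred_eq, inner_zero_framePoint_sub, inner_one_framePoint_sub]
      exact abs_lt.2 ht
    refine ⟨t₀, ht₀, fun t ht => ?_, fun h => (hspos.ne' h).elim, fun _ hdiff => ?_⟩
    · have hsharp := sharp_minimum_of_slopes (c := ε / 2)
        (φ := fun t => f (framePoint e x₀ s t))
        hI hIT hmin' (fun t₁ ht₁ => ?_) t ht
      · exact (add_le_add_right (mul_le_mul_of_nonneg_right (min_le_right _ _)
          (abs_nonneg _)) _).trans hsharp
      · have hz := hsub (hball s hs t₁ (hIT ht₁))
        obtain ⟨q, hq, hqD⟩ := exists_reachableGradient_mem hopen hL hz hVopen (hmemV t₁ ht₁)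
          (T := {q | ε / 2 ≤ |inner ℝ (e 1) q|}) (isClosed_le continuous_const (by fun_prop))
          (fun z hz _ d hd => hVgrad z hz d hd)
        refine ⟨inner ℝ (e 1) q, hq, fun t' ht' => ?_⟩
        have := reachableGradient_inequality hopen hf hL.continuousOn hz
          (hsub (hball s hs t' ht')) hqD
        rwa [framePoint_sub_framePoint, real_inner_smul_right, real_inner_comm, mul_comm] at this
    -- A gradient at the minimizer would have zero `e 1`-component, contrary to the bound on `V`.
    · have hd := hdiff.hasGradientAt
      have h1 := hVgrad _ (hmemV t₀ ⟨(abs_lt.1 ht₀s).1, (abs_lt.1 ht₀s).2⟩) _ hd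
      have hP : HasDerivAt (framePoint e x₀ s) (e 1) t₀ := by
        have := (((hasDerivAt_id t₀).smul_const (e 1)).const_add (s • e 0)).const_add x₀
        rw [one_smul] at this
        exact this
      have hder := hd.hasFDerivAt.comp_hasDerivAt t₀ hP
      have hloc : IsLocalMin (f ∘ framePoint e x₀ s) t₀ := by
        filter_upwards [hI] with t ht using hmin' t (hIT ht)
      have := hloc.hasDerivAt_eq_zero hder
      rw [InnerProductSpace.toDual_apply_apply, real_inner_comm] at this
      rw [this, abs_zero] at h1
      linarith
  choose! y hyT hymin hy0 hyd using main
  obtain ⟨y₁, y₂, h1, h2, h3, h4, hy⟩ := exists_convexOn_sub_of_sharp_minimizer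
    (H := fun s t => f (framePoint e x₀ s t)) hcpos (convex_Icc 0 α)
    (convexOn_framePoint e hf (convex_Icc 0 α) (convex_Icc (-α) α)
      fun s hs t ht => hsub (hball s hs t ht))
    (fun t ht => lipschitzOnWith_framePoint e hL fun s hs => hsub (hball s hs t ht)) hyT hymin
  refine ⟨α, hαpos, y₁, y₂, h1, h2, h3, h4, ?_, fun s hs => ?_⟩
  · rw [hy]
    exact hy0 0 ⟨le_rfl, hαpos.le⟩ rfl
  · rw [hy]
    have hs' : s ∈ Icc 0 α := ⟨hs.1.le, hs.2⟩
    exact ⟨hsub (hball s hs' _ (hyT s hs')), hyd s hs' hs.1⟩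

end Propagation

/-! ### Passing between the semiconcave function and the convex one. -/

section Transfer

variable {E : Type*} [NormedAddCommGroup E] [InnerProductSpace ℝ E] [CompleteSpace E]

/-- The term `κ • (z - x)` disappears in the limit. Since `d ↦ p - d + κ • (z - x)` is an
involution, the lemma serves both from `u` to `f` and back. -/
theorem reachableGradients_transfer {Ω Ω' : Set E} {u f : E → ℝ} {x p q : E} {κ : ℝ}
    (hΩ' : Ω' ∈ 𝓝 x)
    (h : ∀ z ∈ Ω', ∀ d, HasGradientAt u d z → HasGradientAt f (p - d + κ • (z - x)) z)
    (hq : q ∈ reachableGradients Ω u x) : p - q ∈ reachableGradients Ω' f x := by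
  obtain ⟨z, d, hzd, hz, hd⟩ := hq
  obtain ⟨N, hN⟩ := eventually_atTop.1 (hz.eventually hΩ')
  refine ⟨fun n => z (n + N), fun n => p - d (n + N) + κ • (z (n + N) - x), fun n =>
    ⟨hN _ (Nat.le_add_left _ _), h _ (hN _ (Nat.le_add_left _ _)) _ (hzd _).2⟩,
    hz.comp (tendsto_add_atTop_nat N), ?_⟩
  have : Tendsto (fun n => p - d n + κ • (z n - x)) atTop (𝓝 (p - q + κ • (x - x))) :=
    (tendsto_const_nhds.sub hd).add ((hz.sub_const x).const_smul κ)
  rw [sub_self, smul_zero, add_zero] at this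
  exact this.comp (tendsto_add_atTop_nat N)

theorem hasGradientAt_quadratic (K κ : ℝ) (w x z : E) :
    HasGradientAt (fun z => K * ‖z‖ ^ 2 - κ - inner ℝ w (z - x)) ((2 * K) • z - w) z := by
  rw [hasGradientAt_iff_hasFDerivAt]
  have h1 : HasFDerivAt (fun z : E => ‖z‖ ^ 2) (2 • innerSL ℝ z) z :=
    (hasStrictFDerivAt_norm_sq z).hasFDerivAt
  have h2 : HasFDerivAt (fun z => inner ℝ w (z - x)) (innerSL ℝ w) z :=
    (innerSL ℝ w).hasFDerivAt.comp z ((hasFDerivAt_id z).sub_const x)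
  have h3 : InnerProductSpace.toDual ℝ E ((2 * K) • z - w) =
      K • (2 • innerSL ℝ z) - innerSL ℝ w := by
    ext v
    simp
    ring
  rw [h3]
  exact ((h1.const_mul K).sub_const κ).sub h2

theorem hasGradientAt_sub {u v : E → ℝ} {a b z : E} (hu : HasGradientAt u a z)
    (hv : HasGradientAt v b z) : HasGradientAt (fun x => u x - v x) (a - b) z := by
  rw [hasGradientAt_iff_hasFDerivAt, map_sub]
  exact hu.hasFDerivAt.sub hv.hasFDerivAt

end Transfer

/-! ### Adapted frames in the plane. -/

section Plane

theorem exists_orthonormalBasis_fin_two_apply_zero {E : Type*} [NormedAddCommGroup E]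
    [InnerProductSpace ℝ E] [FiniteDimensional ℝ E] (hE : Module.finrank ℝ E = 2) {v : E}
    (hv : ‖v‖ = 1) : ∃ e : OrthonormalBasis (Fin 2) ℝ E, e 0 = v := by
  obtain ⟨b, hb⟩ := Orthonormal.exists_orthonormalBasis_extension_of_card_eq (𝕜 := ℝ) (E := E)
    (ι := Fin 2) (by simpa using hE) (v := fun _ => v) (s := {0})
    ⟨fun _ => hv, fun i j hij => (hij (Subsingleton.elim i j)).elim⟩
  exact ⟨b, hb 0 rfl⟩

theorem exists_affineIsometryEquiv_frame (e : OrthonormalBasis (Fin 2) ℝ (EuclideanSpace ℝ (Fin 2)))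
    (x₀ : EuclideanSpace ℝ (Fin 2)) :
    ∃ A : EuclideanSpace ℝ (Fin 2) ≃ᵃⁱ[ℝ] EuclideanSpace ℝ (Fin 2), A x₀ = 0 ∧
      ∀ y₁ y₂ s, A.symm (graphCurve y₁ y₂ s) = framePoint e x₀ s (y₁ s - y₂ s) := by
  set B := e.repr.symm.toAffineIsometryEquiv.trans
    (AffineIsometryEquiv.constVAdd ℝ (EuclideanSpace ℝ (Fin 2)) x₀) with hB
  have hBx : ∀ v, B v = x₀ + e.repr.symm v := fun v => rfl
  refine ⟨B.symm, ?_, fun y₁ y₂ s => ?_⟩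
  · rw [AffineIsometryEquiv.symm_apply_eq, hBx, map_zero, add_zero]
  · rw [AffineIsometryEquiv.symm_symm, hBx, framePoint, ← e.sum_repr_symm, Fin.sum_univ_two]
    simp [graphCurve]

end Plane

end SemiconcaveSing

/-! ### The main theorem: reduction to the convex case. -/

open SemiconcaveSing in
theorem theorem3p1 (Ω : Set (EuclideanSpace ℝ (Fin 2))) (hΩ : IsOpen Ω)
    (u : EuclideanSpace ℝ (Fin 2) → ℝ) (hu : SemiconcaveSing.IsSemiconcaveOn Ω u)
    (x₀ : EuclideanSpace ℝ (Fin 2)) (hx₀ : x₀ ∈ SemiconcaveSing.singularSet Ω u)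
    (hne : (frontier (SemiconcaveSing.superdifferential Ω u x₀) \
      SemiconcaveSing.reachableGradients Ω u x₀).Nonempty) :
    ∃ (A : EuclideanSpace ℝ (Fin 2) ≃ᵃⁱ[ℝ] EuclideanSpace ℝ (Fin 2)) (α : ℝ) (y₁ y₂ : ℝ → ℝ),
      A x₀ = 0 ∧ 0 < α ∧
      ConvexOn ℝ (Set.Icc 0 α) y₁ ∧ (∃ K, LipschitzOnWith K y₁ (Set.Icc 0 α)) ∧
      ConvexOn ℝ (Set.Icc 0 α) y₂ ∧ (∃ K, LipschitzOnWith K y₂ (Set.Icc 0 α)) ∧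
      SemiconcaveSing.graphCurve y₁ y₂ 0 = 0 ∧
      A.symm '' (SemiconcaveSing.graphCurve y₁ y₂ '' Set.Icc 0 α) ⊆
        SemiconcaveSing.singularSet Ω u ∧
      SemiconcaveSing.HasFiniteTurn (fun x => A.symm (SemiconcaveSing.graphCurve y₁ y₂ x)) 0 α := by
  obtain ⟨p, hpfr, hpD⟩ := hne
  obtain ⟨δ, hδ, hδΩ, K, g, hg, hug⟩ := hu x₀ hx₀.1
  -- This `w` and the constant in `Q` make `Q x₀ = u x₀` and the gradient of `Q` at `x₀` equal to
  -- `p`; on the ball `Q - u` is `-g` plus an affine function.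
  set w : EuclideanSpace ℝ (Fin 2) := (2 * K) • x₀ - p with hw
  set Q : EuclideanSpace ℝ (Fin 2) → ℝ :=
    fun z => K * ‖z‖ ^ 2 - (K * ‖x₀‖ ^ 2 - u x₀) - inner ℝ w (z - x₀) with hQ
  set f : EuclideanSpace ℝ (Fin 2) → ℝ := fun z => Q z - u z with hfdef
  have hQgrad : ∀ z, HasGradientAt Q ((2 * K) • z - w) z := hasGradientAt_quadratic K _ w x₀
  have hcoef : ∀ z d, (2 * K) • z - w - d = p - d + (2 * K) • (z - x₀) := fun z d => by
    rw [hw]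
    module
  have huf : ∀ z d, HasGradientAt u d z → HasGradientAt f (p - d + (2 * K) • (z - x₀)) z :=
    fun z d h => hcoef z d ▸ hasGradientAt_sub (hQgrad z) h
  have hfu : ∀ z d, HasGradientAt f d z → HasGradientAt u (p - d + (2 * K) • (z - x₀)) z :=
    fun z d h => by
      have := hasGradientAt_sub (hQgrad z) h
      rw [hcoef] at this
      simpa only [hfdef, sub_sub_cancel] using this
  have hfconv : ConvexOn ℝ (Metric.ball x₀ δ) f := by
    have h1 : ConvexOn ℝ (Metric.ball x₀ δ)
        fun z => -g z + (-(innerₛₗ ℝ w) z + (inner ℝ w x₀ - (K * ‖x₀‖ ^ 2 - u x₀))) :=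
      hg.neg.add (((-(innerₛₗ ℝ w)).convexOn hg.1).add_const _)
    refine h1.congr fun z hz => ?_
    simp only [hfdef, hQ, hug z hz, inner_sub_right, innerₛₗ_apply_apply]
    ring
  obtain ⟨L, N, hN, hLN⟩ := hfconv.locallyLipschitzOn Metric.isOpen_ball
    (Metric.mem_ball_self hδ)
  rw [Metric.isOpen_ball.nhdsWithin_eq (Metric.mem_ball_self hδ)] at hN
  obtain ⟨r, hr, hrN⟩ := Metric.mem_nhds_iff.1 (inter_mem hN (Metric.ball_mem_nhds x₀ hδ))
  have hL : LipschitzOnWith L f (Metric.ball x₀ r) := hLN.mono fun z hz => (hrN hz).1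
  have hrδ : Metric.ball x₀ r ⊆ Metric.ball x₀ δ := fun z hz => (hrN hz).2
  have hfr : ConvexOn ℝ (Metric.ball x₀ r) f := hfconv.subset hrδ (convex_ball _ _)
  set D := reachableGradients Ω u x₀ with hD
  set D' := reachableGradients (Metric.ball x₀ r) f x₀ with hD'
  have hDD' : ∀ q ∈ D, p - q ∈ D' := fun q hq =>
    reachableGradients_transfer (Metric.ball_mem_nhds x₀ hr) (fun z _ d => huf z d) hq
  have hD'D : ∀ q ∈ D', p - q ∈ D := fun q hq =>
    reachableGradients_transfer (hΩ.mem_nhds hx₀.1) (fun z _ d => hfu z d) hq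
  have hDcomp : IsCompact D := by
    refine Metric.isCompact_of_isClosed_isBounded (isClosed_reachableGradients _ _ _)
      ((Metric.isBounded_closedBall (x := p) (r := L)).subset fun q hq => ?_)
    obtain ⟨z, d, hzd, -, hd⟩ := hDD' q hq
    rw [Metric.mem_closedBall, dist_eq_norm, norm_sub_rev]
    exact le_of_tendsto' hd.norm fun n =>
      norm_le_of_hasGradientAt Metric.isOpen_ball hL (hzd n).1 (hzd n).2
  obtain ⟨v, hv, hsupp⟩ := exists_unit_support_of_mem_frontier (convex_convexHull ℝ D) hpfr
  replace hsupp : ∀ q ∈ D, inner ℝ v q ≤ inner ℝ v p := fun q hq =>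
    hsupp q (subset_convexHull ℝ D hq)
  -- The axis `e 0` is `-v`, since `q ↦ p - q` reverses outer normals.
  obtain ⟨e, he⟩ := exists_orthonormalBasis_fin_two_apply_zero (by simp)
    ((norm_neg v).trans hv)
  have hev : ∀ q, inner ℝ v q = -inner ℝ (e 0) q := fun q => by rw [he, inner_neg_left, neg_neg]
  have huniq : ∀ q ∈ D, inner ℝ v q = inner ℝ v p → inner ℝ (e 1) q ≠ inner ℝ (e 1) p := by
    rintro q hq h0 h1
    refine hpD (?_ : p ∈ D)
    suffices q = p from this ▸ hq
    refine e.repr.injective (PiLp.ext fun i => ?_)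
    rw [e.repr_apply_apply, e.repr_apply_apply]
    fin_cases i
    · simpa [hev] using h0
    · exact h1
  -- The directions `e 1` and `-e 1` give reachable gradients of `u` on either side of `p` on the
  -- supporting line.
  obtain ⟨a, haD, hav, ha⟩ := exists_mem_face_inner_gt hDcomp hpfr.1 hsupp huniq
  obtain ⟨b, hbD, hbv, hb⟩ := exists_mem_face_inner_gt hDcomp hpfr.1 hsupp (w := -e 1)
    fun q hq h => by simpa using huniq q hq h
  simp only [hev, inner_neg_left, neg_inj, neg_lt_neg_iff] at hav hbv hb
  obtain ⟨α, hα, y₁, y₂, hc₁, hl₁, hc₂, hl₂, hy0, hsing⟩ :=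
    exists_dc_arc_of_convexOn e hr hfr hL (by simp [hfdef, hQ])
      (fun h => hpD (by simpa using hD'D 0 h))
      (fun q hq => by
        have := hsupp _ (hD'D q hq)
        rw [hev, hev, inner_sub_right] at this
        linarith)
      ⟨p - a, hDD' a haD, by rw [inner_sub_right]; linarith, by rw [inner_sub_right]; linarith⟩
      ⟨p - b, hDD' b hbD, by rw [inner_sub_right]; linarith, by rw [inner_sub_right]; linarith⟩
  obtain ⟨A, hA, hAsymm⟩ := exists_affineIsometryEquiv_frame e x₀
  refine ⟨A, α, y₁, y₂, hA, hα, hc₁, hl₁, hc₂, hl₂, ?_, ?_,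
    (hasFiniteTurn_graphCurve hc₁ hc₂ hl₁ hl₂).comp_affineIsometryEquiv A.symm⟩
  · ext i
    fin_cases i <;> simp [graphCurve, hy0]
  · rintro _ ⟨_, ⟨s, hs, rfl⟩, rfl⟩
    rw [hAsymm]
    rcases hs.1.eq_or_lt with rfl | hspos
    · rw [hy0]
      simpa [framePoint] using hx₀
    · obtain ⟨h1, h2⟩ := hsing s ⟨hspos, hs.2⟩
      exact ⟨hδΩ (hrδ h1), fun hdiff => h2 (huf _ _ hdiff.hasGradientAt).differentiableAt⟩
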